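/- Cubes in $\mathbb{R}^n$ have sides parallel to the coordinate axes and positive side length, $|Q|$ is the Lebesgue measure of $Q$, and $f_Q=\frac1{|Q|}\int_Q f$. For a locally integrable function $f:\mathbb{R}^n\to\mathbb{R}$ put $$Mf(x)=\sup_{Q\ni x}\frac1{|Q|}\int_Q|f(y)|\,dy,\qquad M^\#f(x)=\sup_{Q\ni x}\frac1{|Q|}\int_Q|f(y)-f_Q|\,dy,\qquad \|f\|_{\mathrm{BMO}}=\sup_Q\frac1{|Q|}\int_Q|f(y)-f_Q|\,dy,$$ the suprema being over cubes, and write $f\in\mathrm{BMO}$ if $\|f\|_{\mathrm{BMO}}<\infty$. A weight is a locally integrable function $w$ on $\mathbb{R}^n$ that is positive almost everywhere; $w(Q)=\int_Q w$, and $w\in A_\infty$ means that its Fujii–Wilson constant $$[w]_{A_\infty}=\sup_Q\frac1{w(Q)}\int_Q M(w\chi_Q)(x)\,dx$$ is finite. Theorem. For every $n$ there is a constant $c_n>0$, depending only on $n$, such that the following holds. Let $f:\mathbb{R}^n\to\mathbb{R}$ be a locally integrable function that is not almost everywhere equal to a constant and such that $Mf$ is not identically infinite, and let $w\in A_\infty$.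 Then, for every cube $Q$ and every $1\le p<\infty$, $$\left(\frac1{w(Q)}\int_Q\left(\frac{Mf(x)-\operatorname{ess\,inf}_Q Mf}{M^\#f(x)}\right)^p w(x)\,dx\right)^{1/p}\le c_n\,[w]_{A_\infty}\,p.$$ In particular, if moreover $f\in\mathrm{BMO}$, then for every cube $Q$ and every $1\le p<\infty$, $$\left(\frac1{w(Q)}\int_Q\left(Mf(x)-\operatorname{ess\,inf}_Q Mf\right)^p w(x)\,dx\right)^{1/p}\le c_n\,[w]_{A_\infty}\,p\,\|f\|_{\mathrm{BMO}}.$$ -/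

import Mathlib

open MeasureTheory Set
open scoped ENNReal

noncomputable section

/-- `Q` is a (nondegenerate, closed) cube of `ℝⁿ` with sides parallel to the coordinate axes:
`Q = [a₁, a₁ + l] × ⋯ × [aₙ, aₙ + l]` with side length `l > 0`. -/
def IsCube {n : ℕ} (Q : Set (Fin n → ℝ)) : Prop :=
  ∃ (a : Fin n → ℝ) (l : ℝ), 0 < l ∧ Q = Icc a (fun i => a i + l)

/-- The (uncentered) Hardy-Littlewood maximal function
`Mf(x) = sup_{Q ∋ x} |Q|⁻¹ ∫_Q |f|`, with values in `[0, ∞]`. -/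
def hlMaximal {n : ℕ} (f : (Fin n → ℝ) → ℝ) (x : Fin n → ℝ) : ℝ≥0∞ :=
  ⨆ (Q : Set (Fin n → ℝ)) (_ : IsCube Q ∧ x ∈ Q), (∫⁻ y in Q, ‖f y‖ₑ) / volume Q

/-- The mean oscillation `|Q|⁻¹ ∫_Q |f - f_Q|`, where `f_Q = |Q|⁻¹ ∫_Q f`. -/
def meanOsc {n : ℕ} (f : (Fin n → ℝ) → ℝ) (Q : Set (Fin n → ℝ)) : ℝ≥0∞ :=
  (∫⁻ y in Q, ‖f y - ⨍ z in Q, f z‖ₑ) / volume Q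

/-- The Fefferman-Stein sharp maximal function `M^♯f(x) = sup_{Q ∋ x} |Q|⁻¹ ∫_Q |f - f_Q|`. -/
def sharpMaximal {n : ℕ} (f : (Fin n → ℝ) → ℝ) (x : Fin n → ℝ) : ℝ≥0∞ :=
  ⨆ (Q : Set (Fin n → ℝ)) (_ : IsCube Q ∧ x ∈ Q), meanOsc f Q

/-- The seminorm `‖f‖_BMO = sup_Q |Q|⁻¹ ∫_Q |f - f_Q|`, with values in `[0, ∞]`. -/
def bmoNorm {n : ℕ} (f : (Fin n → ℝ) → ℝ) : ℝ≥0∞ :=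
  ⨆ (Q : Set (Fin n → ℝ)) (_ : IsCube Q), meanOsc f Q

/-- `f ∈ BMO`: `f` is locally integrable and `‖f‖_BMO < ∞`. -/
def MemBMO {n : ℕ} (f : (Fin n → ℝ) → ℝ) : Prop :=
  LocallyIntegrable f volume ∧ bmoNorm f < ∞

/-- A weight: a locally integrable function that is positive almost everywhere. -/
def IsWeight {n : ℕ} (w : (Fin n → ℝ) → ℝ) : Prop :=
  LocallyIntegrable w volume ∧ ∀ᵐ x, 0 < w x

/-- `w(Q) = ∫_Q w`. -/
def weightMass {n : ℕ} (w : (Fin n → ℝ) → ℝ) (Q : Set (Fin n → ℝ)) : ℝ≥0∞ :=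
  ∫⁻ x in Q, ENNReal.ofReal (w x)

/-- The Fujii-Wilson constant `[w]_{A_∞} = sup_Q w(Q)⁻¹ ∫_Q M(w χ_Q)`. -/
def fujiiWilson {n : ℕ} (w : (Fin n → ℝ) → ℝ) : ℝ≥0∞ :=
  ⨆ (Q : Set (Fin n → ℝ)) (_ : IsCube Q), (∫⁻ x in Q, hlMaximal (Q.indicator w) x) / weightMass w Q

/-- `w` is an `A_∞` weight: a weight with finite Fujii-Wilson constant. -/
def MemAInfty {n : ℕ} (w : (Fin n → ℝ) → ℝ) : Prop :=
  IsWeight w ∧ fujiiWilson w < ∞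

/-- The essential infimum of `g` over `Q` (with respect to Lebesgue measure). -/
def essInfOn {n : ℕ} (g : (Fin n → ℝ) → ℝ≥0∞) (Q : Set (Fin n → ℝ)) : ℝ≥0∞ :=
  essInf g (volume.restrict Q)

/-- The weighted `L^p` average `(w(Q)⁻¹ ∫_Q g^p w)^{1/p}` of a function `g ≥ 0`. -/
def weightedLpAvg {n : ℕ} (w : (Fin n → ℝ) → ℝ) (Q : Set (Fin n → ℝ)) (p : ℝ)
    (g : (Fin n → ℝ) → ℝ≥0∞) : ℝ≥0∞ :=
  ((∫⁻ x in Q, g x ^ p * ENNReal.ofReal (w x)) / weightMass w Q) ^ (1 / p)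

end

/-! Write `C` for `sharpConst n`. On most of a cube `Q`, `Mf ≤ inf_Q Mf + C M^♯f`. Averages over
cubes larger than `Q` are compared with the mean over a cube containing both; averages over smaller
cubes with the mean over `3Q`, where the weak-type bound makes the exceptional set a small fraction
of `Q` (`hlMaximal_le_of_notMem_exceptionalSet`, `volume_exceptionalSet_le`).

Calderón–Zygmund stopping cubes cover the exceptional set, fill at most half of `Q`, and each
contains a good point, so `inf_P Mf ≤ inf_Q Mf + C M^♯f(x)` for every `x ∈ P`
(`exists_sparse_children`). Since `M^♯f` is always taken at the same point `x`, iteration gives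
`Mf(x) ≤ inf_Q Mf + C N(x) M^♯f(x)` almost everywhere on `Q`, where `N(x)` counts the generations
containing `x` (`exists_sparseRule_hlMaximal_le`).

Only `N` remains to be integrated against `w`. Sparseness and the Fujii–Wilson condition give
Carleson packing with constant `2[w]` (`tsum_weightMeasure_level_le`), and packing bounds the `k`-th
moment of `N` by `k! (2[w])^k w(Q)` (`lintegral_countFrom_pow_le`). The `k`-th root is linear in
`k`, hence in `p`. -/

/-! ### Half-open cubes and their dyadic grids -/

/-- A half-open cube `[a₁, a₁ + l) × ⋯ × [aₙ, aₙ + l)`, given by its corner and its side length. -/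
structure HalfOpenCube (n : ℕ) where
  corner : Fin n → ℝ
  side : ℝ
  side_pos : 0 < side

namespace HalfOpenCube

variable {n : ℕ}

/-- The points of a half-open cube. -/
def points (Q : HalfOpenCube n) : Set (Fin n → ℝ) :=
  univ.pi fun i => Ico (Q.corner i) (Q.corner i + Q.side)

/-- The closed cube with the same corner and side length. -/
def closedCube (Q : HalfOpenCube n) : Set (Fin n → ℝ) :=
  Icc Q.corner fun i => Q.corner i + Q.side

theorem mem_points {Q : HalfOpenCube n} {x : Fin n → ℝ} :
    x ∈ Q.points ↔ ∀ i, Q.corner i ≤ x i ∧ x i < Q.corner i + Q.side := by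
  simp [points]

theorem isCube_closedCube (Q : HalfOpenCube n) : IsCube Q.closedCube :=
  ⟨_, _, Q.side_pos, rfl⟩

theorem points_subset_closedCube (Q : HalfOpenCube n) : Q.points ⊆ Q.closedCube := fun _ hx =>
  ⟨fun i => (mem_points.1 hx i).1, fun i => (mem_points.1 hx i).2.le⟩

/-- Half-open cubes tile exactly, while the maximal functions use closed ones; the null boundary
allows passing between them. -/
theorem points_ae_eq_closedCube (Q : HalfOpenCube n) : Q.points =ᵐ[volume] Q.closedCube :=
  Measure.univ_pi_Ico_ae_eq_Icc

theorem measurableSet_points (Q : HalfOpenCube n) : MeasurableSet Q.points :=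
  MeasurableSet.univ_pi fun _ => measurableSet_Ico

theorem measurableSet_closedCube (Q : HalfOpenCube n) : MeasurableSet Q.closedCube :=
  measurableSet_Icc

theorem volume_points (Q : HalfOpenCube n) : volume Q.points = ENNReal.ofReal Q.side ^ n := by
  rw [points, Real.volume_pi_Ico]
  simp

theorem volume_points_ne_zero (Q : HalfOpenCube n) : volume Q.points ≠ 0 := by
  rw [volume_points]
  exact pow_ne_zero _ (by simpa using Q.side_pos)

theorem volume_points_ne_top (Q : HalfOpenCube n) : volume Q.points ≠ ∞ := by
  rw [volume_points]
  finiteness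

theorem corner_mem_points (Q : HalfOpenCube n) : Q.corner ∈ Q.points :=
  mem_points.2 fun _ => ⟨le_rfl, lt_add_of_pos_right _ Q.side_pos⟩

theorem volume_closedCube (Q : HalfOpenCube n) :
    volume Q.closedCube = ENNReal.ofReal Q.side ^ n := by
  rw [← measure_congr Q.points_ae_eq_closedCube, volume_points]

theorem volume_closedCube_ne_zero (Q : HalfOpenCube n) : volume Q.closedCube ≠ 0 := by
  rw [← measure_congr Q.points_ae_eq_closedCube]
  exact Q.volume_points_ne_zero

theorem volume_closedCube_ne_top (Q : HalfOpenCube n) : volume Q.closedCube ≠ ∞ := by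
  rw [← measure_congr Q.points_ae_eq_closedCube]
  exact Q.volume_points_ne_top

theorem nonempty_interior_closedCube (Q : HalfOpenCube n) : (interior Q.closedCube).Nonempty := by
  have hs := Q.side_pos
  refine ⟨fun i => Q.corner i + Q.side / 2, ?_⟩
  rw [closedCube, ← pi_univ_Icc, interior_pi_set finite_univ]
  intro i _
  simp only [interior_Icc, mem_Ioo]
  constructor <;> linarith

/-- The `k`-th dyadic subcube of `Q` with index `z`. -/
noncomputable def dyadic (Q : HalfOpenCube n) (k : ℕ) (z : Fin n → ℤ) : HalfOpenCube n where
  corner i := Q.corner i + z i * (Q.side / 2 ^ k)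
  side := Q.side / 2 ^ k
  side_pos := div_pos Q.side_pos (by positivity)

/-- The index of the dyadic cube of generation `k` containing `x`. -/
noncomputable def dyadicIndex (Q : HalfOpenCube n) (k : ℕ) (x : Fin n → ℝ) (i : Fin n) : ℤ :=
  ⌊(x i - Q.corner i) / Q.side * 2 ^ k⌋

theorem mem_dyadic {Q : HalfOpenCube n} {k : ℕ} {z : Fin n → ℤ} {x : Fin n → ℝ} :
    x ∈ (Q.dyadic k z).points ↔ Q.dyadicIndex k x = z := by
  have hs := Q.side_pos
  rw [mem_points, funext_iff]
  refine forall_congr' fun i => ?_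
  rw [dyadicIndex, Int.floor_eq_iff]
  have h2 : (0 : ℝ) < 2 ^ k := by positivity
  have e : (x i - Q.corner i) / Q.side * 2 ^ k = (x i - Q.corner i) / (Q.side / 2 ^ k) := by
    field_simp
  rw [e, le_div_iff₀ (div_pos hs h2), div_lt_iff₀ (div_pos hs h2)]
  simp only [dyadic]
  constructor <;> rintro ⟨h, h'⟩ <;> constructor <;> linarith

/-- Nesting of the grids: the coarse index is the integer quotient of the fine index by `2 ^ (k -
j)`. -/
theorem dyadicIndex_eq_of_le {Q : HalfOpenCube n} {j k : ℕ} (hjk : j ≤ k) {x y : Fin n → ℝ}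
    (h : Q.dyadicIndex k x = Q.dyadicIndex k y) : Q.dyadicIndex j x = Q.dyadicIndex j y := by
  have key : ∀ (u : Fin n → ℝ) (i : Fin n),
      Q.dyadicIndex j u i = Q.dyadicIndex k u i / ((2 ^ (k - j) : ℕ) : ℤ) := by
    intro u i
    rw [dyadicIndex, dyadicIndex, ← Int.floor_div_natCast]
    congr 1
    obtain ⟨m, rfl⟩ := Nat.exists_eq_add_of_le hjk
    simp only [Nat.add_sub_cancel_left, pow_add]
    push_cast
    field_simp
  funext i
  rw [key, key, h]

theorem dyadic_subset_dyadic {Q : HalfOpenCube n} {j k : ℕ} (hjk : j ≤ k) (x : Fin n → ℝ) :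
    (Q.dyadic k (Q.dyadicIndex k x)).points ⊆ (Q.dyadic j (Q.dyadicIndex j x)).points :=
  fun _ hy => mem_dyadic.2 (dyadicIndex_eq_of_le hjk (mem_dyadic.1 hy))

theorem dyadic_zero_zero (Q : HalfOpenCube n) : Q.dyadic 0 0 = Q := by
  cases Q
  simp [dyadic]

theorem volume_dyadic_succ (Q : HalfOpenCube n) (k : ℕ) (z z' : Fin n → ℤ) :
    volume (Q.dyadic k z).points = 2 ^ n * volume (Q.dyadic (k + 1) z').points := by
  rw [volume_points, volume_points, ← mul_pow]
  congr 1
  rw [← ENNReal.ofReal_ofNat 2, ← ENNReal.ofReal_mul (by norm_num)]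
  congr 1
  simp only [dyadic, pow_succ]
  field_simp

theorem exists_dyadic_subset {Q : HalfOpenCube n} {U : Set (Fin n → ℝ)} (hU : IsOpen U)
    {x : Fin n → ℝ} (hx : x ∈ U) : ∃ k, (Q.dyadic k (Q.dyadicIndex k x)).points ⊆ U := by
  obtain ⟨ε, hε, hb⟩ := Metric.isOpen_iff.1 hU x hx
  obtain ⟨k, hk⟩ := exists_pow_lt_of_lt_one (div_pos hε Q.side_pos) (by norm_num : (1 / 2 : ℝ) < 1)
  refine ⟨k, fun y hy => hb ?_⟩
  have hxm : x ∈ (Q.dyadic k (Q.dyadicIndex k x)).points := mem_dyadic.2 rfl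
  have hs : Q.side / 2 ^ k < ε := by
    rw [lt_div_iff₀ Q.side_pos] at hk
    calc Q.side / 2 ^ k = (1 / 2) ^ k * Q.side := by rw [one_div, inv_pow]; ring
      _ < ε := hk
  rw [Metric.mem_ball, dist_pi_lt_iff hε]
  intro i
  have h1 := mem_points.1 hy i
  have h2 := mem_points.1 hxm i
  have h3 : (Q.dyadic k (Q.dyadicIndex k x)).side = Q.side / 2 ^ k := rfl
  rw [Real.dist_eq, abs_lt]
  constructor <;> linarith

/-! ### Stopping cubes and the weak-type bound -/

/-- Calderón–Zygmund decomposition of an open set which occupies a small part of a cube. -/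
theorem exists_calderonZygmund (Q : HalfOpenCube n) {U : Set (Fin n → ℝ)} (hU : IsOpen U)
    (hvol : 2 ^ (n + 2) * volume (U ∩ Q.points) ≤ volume Q.points) :
    ∃ S : Set (HalfOpenCube n), S.Countable ∧ S.PairwiseDisjoint points ∧
      (∀ P ∈ S, P.points ⊆ Q.points) ∧ U ∩ Q.points ⊆ ⋃ P ∈ S, P.points ∧
      (∀ P ∈ S, ¬ P.points ⊆ U) ∧ 2 * volume (⋃ P ∈ S, P.points) ≤ volume Q.points := by
  -- `U` has density above `2 ^ -(n + 1)`. The root is not heavy by `hvol`, and `T` collects the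
  -- first heavy cubes. A light parent meets `U` in measure at most half that of each child, so a
  -- selected cube cannot lie in `U`.
  let heavy : ℕ → (Fin n → ℤ) → Prop := fun k z =>
    volume (Q.dyadic k z).points < 2 ^ (n + 1) * volume (U ∩ (Q.dyadic k z).points)
  let T : Set (ℕ × (Fin n → ℤ)) := {p | (Q.dyadic p.1 p.2).points ⊆ Q.points ∧ heavy p.1 p.2 ∧
    ∀ x ∈ (Q.dyadic p.1 p.2).points, ∀ j < p.1, ¬ heavy j (Q.dyadicIndex j x)}
  let D : ℕ × (Fin n → ℤ) → HalfOpenCube n := fun p => Q.dyadic p.1 p.2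
  have hcount : (D '' T).Countable := (to_countable T).image D
  have hroot : ¬ heavy 0 0 := by
    simp only [heavy, dyadic_zero_zero, not_lt]
    refine le_trans ?_ hvol
    gcongr <;> norm_num
  have hdisj : (D '' T).PairwiseDisjoint points := by
    rintro _ ⟨⟨k, z⟩, hp, rfl⟩ _ ⟨⟨k', z'⟩, hp', rfl⟩ hne
    refine Set.disjoint_left.2 fun x hx hx' => hne ?_
    have hz := mem_dyadic.1 hx
    have hz' := mem_dyadic.1 hx'
    simp only at hz hz'
    rcases lt_trichotomy k k' with h | h | h
    · exact absurd hp.2.1 (by simpa [hz] using hp'.2.2 x hx' k h)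
    · subst h
      rw [← hz, ← hz']
    · exact absurd hp'.2.1 (by simpa [hz'] using hp.2.2 x hx k' h)
  refine ⟨D '' T, hcount, hdisj, ?_, ?_, ?_, ?_⟩
  · rintro _ ⟨p, hp, rfl⟩
    exact hp.1
  · classical
    rintro x ⟨hxU, hxQ⟩
    have hx0 : Q.dyadicIndex 0 x = 0 := by
      rw [← mem_dyadic, dyadic_zero_zero]
      exact hxQ
    -- As `U` is open, small dyadic cubes around `x` lie inside it and have density one.
    have hex : ∃ k, heavy k (Q.dyadicIndex k x) := by
      obtain ⟨k, hk⟩ := exists_dyadic_subset (Q := Q) hU hxU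
      refine ⟨k, ?_⟩
      simp only [heavy]
      rw [inter_eq_self_of_subset_right hk]
      conv_lhs => rw [← one_mul (volume _)]
      exact ENNReal.mul_lt_mul_left (volume_points_ne_zero _) (volume_points_ne_top _)
        (one_lt_pow₀ (by norm_num) (by simp))
    refine mem_biUnion (x := D (Nat.find hex, Q.dyadicIndex (Nat.find hex) x)) ⟨_, ⟨?_, ?_, ?_⟩, rfl⟩
      (mem_dyadic.2 rfl)
    · refine (dyadic_subset_dyadic (Nat.zero_le _) x).trans ?_
      rw [hx0, dyadic_zero_zero]
    · exact Nat.find_spec hex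
    · intro y hy j hj
      rw [dyadicIndex_eq_of_le hj.le (mem_dyadic.1 hy)]
      exact Nat.find_min hex hj
  · rintro _ ⟨⟨k, z⟩, ⟨hsub, hh, hmin⟩, rfl⟩ hPU
    simp only [D] at hPU hsub hh hmin
    cases k with
    | zero =>
      have hc := corner_mem_points (Q.dyadic 0 z)
      have h1 : Q.dyadicIndex 0 (Q.dyadic 0 z).corner = z := mem_dyadic.1 hc
      have h2 : Q.dyadicIndex 0 (Q.dyadic 0 z).corner = 0 := by
        rw [← mem_dyadic, dyadic_zero_zero]
        exact hsub hc
      rw [h1] at h2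
      rw [h2] at hh
      exact hroot hh
    | succ k =>
      set P := Q.dyadic (k + 1) z
      have hc := corner_mem_points P
      have hz : Q.dyadicIndex (k + 1) P.corner = z := mem_dyadic.1 hc
      have hpar := hmin _ hc k (Nat.lt_succ_self k)
      have hsubpar : P.points ⊆ (Q.dyadic k (Q.dyadicIndex k P.corner)).points := by
        have := dyadic_subset_dyadic (Q := Q) (Nat.le_succ k) P.corner
        rwa [Nat.succ_eq_add_one, hz] at this
      simp only [heavy, not_lt] at hpar
      rw [volume_dyadic_succ Q k _ z] at hpar
      have h3 : 2 ^ n * (2 * volume P.points) ≤ 2 ^ n * volume P.points := by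
        refine le_trans ?_ hpar
        rw [← mul_assoc, ← pow_succ]
        gcongr
        exact subset_inter hPU hsubpar
      have h4 := (ENNReal.mul_le_mul_iff_right (by simp) (by finiteness)).1 h3
      have h5 : volume P.points < 2 * volume P.points := by
        conv_lhs => rw [← one_mul (volume _)]
        exact ENNReal.mul_lt_mul_left (volume_points_ne_zero _) (volume_points_ne_top _)
          (by norm_num)
      exact absurd h4 (not_le.2 h5)
  · have hm : ∀ P ∈ D '' T, MeasurableSet P.points := fun P _ => P.measurableSet_points
    have h2 : (2 : ℝ≥0∞) ^ (n + 1) * volume (U ∩ Q.points) * 2 ≤ volume Q.points := by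
      rw [mul_right_comm, ← pow_succ]
      exact hvol
    rw [mul_comm]
    refine le_trans (mul_le_mul_left ?_ _) h2
    rw [measure_biUnion hcount hdisj hm]
    calc ∑' P : D '' T, volume (P : HalfOpenCube n).points
        ≤ ∑' P : D '' T, 2 ^ (n + 1) * volume (U ∩ (P : HalfOpenCube n).points) := by
          refine ENNReal.tsum_le_tsum ?_
          rintro ⟨_, p, hp, rfl⟩
          exact hp.2.1.le
      _ = 2 ^ (n + 1) * volume (⋃ P ∈ D '' T, U ∩ P.points) := by
          rw [ENNReal.tsum_mul_left, measure_biUnion hcount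
            (hdisj.mono fun P => inter_subset_right)
            fun P _ => hU.measurableSet.inter P.measurableSet_points]
      _ ≤ _ := by
          gcongr
          refine iUnion₂_subset ?_
          rintro _ ⟨p, hp, rfl⟩
          exact inter_subset_inter_right _ hp.1

/-- The weak-type estimate for averages over cubes, via the Vitali covering lemma. -/
theorem mul_volume_le_of_forall_exists_average (g : (Fin n → ℝ) → ℝ≥0∞) {E K : Set (Fin n → ℝ)}
    (L : ℝ) (t : ℝ≥0∞)
    (hE : ∀ x ∈ E, ∃ R : HalfOpenCube n, R.side ≤ L ∧ x ∈ R.closedCube ∧ R.closedCube ⊆ K ∧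
      t * volume R.closedCube ≤ ∫⁻ y in R.closedCube, g y) :
    t * volume E ≤ 5 ^ n * ∫⁻ y in K, g y := by
  let F : Set (HalfOpenCube n) := {R | R.side ≤ L ∧ R.closedCube ⊆ K ∧
      t * volume R.closedCube ≤ ∫⁻ y in R.closedCube, g y}
  obtain ⟨u, huF, hdisj, hcov⟩ := Vitali.exists_disjoint_subfamily_covering_enlargement
    closedCube F side 2 (by norm_num) (fun R _ => R.side_pos.le) L (fun R hR => hR.1)
    fun R _ => ⟨_, R.points_subset_closedCube R.corner_mem_points⟩
  have hcount : u.Countable :=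
    hdisj.countable_of_nonempty_interior fun R _ => R.nonempty_interior_closedCube
  -- A cube meeting `R` with side at most `2 * R.side` lies in the concentric fivefold enlargement.
  let big : HalfOpenCube n → HalfOpenCube n := fun R =>
    ⟨fun i => R.corner i - 2 * R.side, 5 * R.side, by linarith [R.side_pos]⟩
  have hEsub : E ⊆ ⋃ R ∈ u, (big R).closedCube := by
    intro x hx
    obtain ⟨R, hRL, hxR, hRK, ht⟩ := hE x hx
    obtain ⟨R', hR', ⟨y, hy, hy'⟩, hs⟩ := hcov R ⟨hRL, hRK, ht⟩
    refine mem_biUnion hR' ⟨fun i => ?_, fun i => ?_⟩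
    · have h1 := hxR.1 i
      have h2 := hy.2 i
      have h3 := hy'.1 i
      simp only [big] at *
      linarith
    · have h1 := hxR.2 i
      have h2 := hy.1 i
      have h3 := hy'.2 i
      simp only [big] at *
      linarith
  have hbig : ∀ R, volume (big R).closedCube = 5 ^ n * volume R.closedCube := by
    intro R
    rw [volume_closedCube, volume_closedCube, ← mul_pow]
    congr 1
    rw [ENNReal.ofReal_mul (by norm_num), ENNReal.ofReal_ofNat]
  have := hcount.to_subtype
  calc t * volume E ≤ t * ∑' R : u, volume (big R).closedCube := by
        gcongr
        exact (measure_mono hEsub).trans (measure_biUnion_le _ hcount _)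
    _ = 5 ^ n * ∑' R : u, t * volume (R : HalfOpenCube n).closedCube := by
        simp only [hbig, ENNReal.tsum_mul_left]
        ring
    _ ≤ 5 ^ n * ∑' R : u, ∫⁻ y in (R : HalfOpenCube n).closedCube, g y := by
        gcongr with R
        exact (huF R.2).2.2
    _ = 5 ^ n * ∫⁻ y in ⋃ R ∈ u, R.closedCube, g y := by
        rw [lintegral_biUnion hcount (fun R _ => R.measurableSet_closedCube) hdisj]
    _ ≤ _ := by
        gcongr
        exact iUnion₂_subset fun R hR => (huF hR).2.1

end HalfOpenCube

/-! ### Local comparison of the maximal and sharp maximal functions -/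

section LocalOscillation

variable {n : ℕ} {f : (Fin n → ℝ) → ℝ}

theorem IsCube.exists_closedCube {K : Set (Fin n → ℝ)} (hK : IsCube K) :
    ∃ Q : HalfOpenCube n, K = Q.closedCube := by
  obtain ⟨a, l, hl, rfl⟩ := hK
  exact ⟨⟨a, l, hl⟩, rfl⟩

theorem average_le_hlMaximal (R : HalfOpenCube n) {x : Fin n → ℝ} (hx : x ∈ R.closedCube) :
    (∫⁻ y in R.closedCube, ‖f y‖ₑ) / volume R.closedCube ≤ hlMaximal f x :=
  le_iSup₂_of_le R.closedCube ⟨R.isCube_closedCube, hx⟩ le_rfl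

theorem meanOsc_le_sharpMaximal (R : HalfOpenCube n) {x : Fin n → ℝ} (hx : x ∈ R.closedCube) :
    meanOsc f R.closedCube ≤ sharpMaximal f x :=
  le_iSup₂_of_le R.closedCube ⟨R.isCube_closedCube, hx⟩ le_rfl

theorem sharpMaximal_le_bmoNorm (x : Fin n → ℝ) : sharpMaximal f x ≤ bmoNorm f :=
  iSup₂_le fun R hR => le_iSup₂_of_le R hR.1 le_rfl

theorem enorm_setAverage_le (K : Set (Fin n → ℝ)) :
    ‖⨍ y in K, f y‖ₑ ≤ (∫⁻ y in K, ‖f y‖ₑ) / volume K := by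
  rw [← setLAverage_eq]
  exact enorm_integral_le_lintegral_enorm _

theorem average_le_enorm_add (R : HalfOpenCube n) (c : ℝ) :
    (∫⁻ y in R.closedCube, ‖f y‖ₑ) / volume R.closedCube ≤
      ‖c‖ₑ + (∫⁻ y in R.closedCube, ‖f y - c‖ₑ) / volume R.closedCube := by
  calc (∫⁻ y in R.closedCube, ‖f y‖ₑ) / volume R.closedCube
      ≤ (∫⁻ y in R.closedCube, (‖c‖ₑ + ‖f y - c‖ₑ)) / volume R.closedCube := by
        gcongr with y
        simpa using enorm_add_le c (f y - c)
    _ = _ := by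
        rw [lintegral_add_left measurable_const, setLIntegral_const, ENNReal.add_div,
          ENNReal.mul_div_cancel_right R.volume_closedCube_ne_zero R.volume_closedCube_ne_top]

/-- The infimum of the maximal function over the half-open cube. -/
noncomputable def infMaximal (f : (Fin n → ℝ) → ℝ) (Q : HalfOpenCube n) : ℝ≥0∞ :=
  ⨅ y ∈ Q.points, hlMaximal f y

/-- The iteration uses the true infimum because one good point of a subcube bounds it; the essential
infimum of the theorem is only larger, which helps when subtracted. -/
theorem infMaximal_le_essInfOn (f : (Fin n → ℝ) → ℝ) (Q : HalfOpenCube n) :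
    infMaximal f Q ≤ essInfOn (hlMaximal f) Q.closedCube := by
  rw [essInfOn, ← Measure.restrict_congr_set Q.points_ae_eq_closedCube]
  refine le_essInf_of_ae_le _ ?_
  filter_upwards [ae_restrict_mem Q.measurableSet_points] with x hx
  exact iInf₂_le x hx

theorem enorm_setAverage_le_infMaximal {Q R : HalfOpenCube n}
    (h : Q.points ⊆ R.closedCube) : ‖⨍ y in R.closedCube, f y‖ₑ ≤ infMaximal f Q :=
  (enorm_setAverage_le _).trans (le_iInf₂ fun _ hy => average_le_hlMaximal R (h hy))

/-- A cube `B` of side at most `2 * R.side` contains both cubes, as they share `x`. Its mean is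
below the infimum over `Q`, and replacing `B` by `R` in the oscillation costs `2 ^ n`. -/
theorem average_le_of_side_le {Q R : HalfOpenCube n} (hside : Q.side ≤ R.side)
    {x z : Fin n → ℝ} (hx : x ∈ Q.points) (hxR : x ∈ R.closedCube) (hz : z ∈ Q.points) :
    (∫⁻ y in R.closedCube, ‖f y‖ₑ) / volume R.closedCube ≤
      infMaximal f Q + 2 ^ n * sharpMaximal f z := by
  let B : HalfOpenCube n := ⟨fun i => min (R.corner i) (Q.corner i), R.side + Q.side,
    add_pos R.side_pos Q.side_pos⟩
  have hQx := Q.points_subset_closedCube hx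
  have hRB : R.closedCube ⊆ B.closedCube := by
    refine fun y hy => ⟨fun i => (min_le_left _ _).trans (hy.1 i), fun i => ?_⟩
    have h1 := hy.2 i
    have h2 := hxR.1 i
    have h3 := hQx.2 i
    have h4 := Q.side_pos
    simp only [B]
    rcases min_cases (R.corner i) (Q.corner i) with h | h <;> linarith
  have hQB : Q.points ⊆ B.closedCube := by
    refine Q.points_subset_closedCube.trans fun y hy =>
      ⟨fun i => (min_le_right _ _).trans (hy.1 i), fun i => ?_⟩
    have h1 := hy.2 i
    have h2 := hQx.1 i
    have h3 := hxR.2 i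
    have h4 := R.side_pos
    simp only [B]
    rcases min_cases (R.corner i) (Q.corner i) with h | h <;> linarith
  have hvol : volume B.closedCube ≤ 2 ^ n * volume R.closedCube := by
    rw [HalfOpenCube.volume_closedCube, HalfOpenCube.volume_closedCube, ← mul_pow,
      ← ENNReal.ofReal_ofNat 2, ← ENNReal.ofReal_mul (by norm_num)]
    gcongr
    simp only [B]
    linarith
  refine (average_le_enorm_add R (⨍ y in B.closedCube, f y)).trans
    (add_le_add (enorm_setAverage_le_infMaximal hQB) ?_)
  refine le_trans ?_ (mul_le_mul_right (meanOsc_le_sharpMaximal B (hQB hz)) _)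
  rw [meanOsc, ← mul_div_assoc]
  refine ENNReal.div_le_of_le_mul ?_
  rw [ENNReal.mul_comm_div, mul_comm (2 ^ n : ℝ≥0∞), mul_assoc]
  refine (lintegral_mono_set hRB).trans (le_mul_of_one_le_right (zero_le) ?_)
  rw [← mul_div_assoc, ENNReal.le_div_iff_mul_le (Or.inl B.volume_closedCube_ne_zero)
    (Or.inl B.volume_closedCube_ne_top), one_mul]
  exact hvol

/-- The cube with the same center and three times the side length. -/
def HalfOpenCube.triple (Q : HalfOpenCube n) : HalfOpenCube n where
  corner i := Q.corner i - Q.side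
  side := 3 * Q.side
  side_pos := mul_pos three_pos Q.side_pos

theorem HalfOpenCube.points_subset_triple (Q : HalfOpenCube n) :
    Q.points ⊆ Q.triple.closedCube := by
  refine fun x hx => ⟨fun i => ?_, fun i => ?_⟩ <;>
  · have h := mem_points.1 hx i
    have h' := Q.side_pos
    simp only [triple]
    linarith

/-- The constant in the comparison of the maximal and the sharp maximal function. -/
noncomputable def sharpConst (n : ℕ) : ℝ≥0∞ := 2 ^ (n + 3) * 15 ^ n

/-- The part of `Q` where the local maximal function of `f - f_{3Q}` exceeds a large multiple of
the mean oscillation of `f` on `3Q`. -/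
def exceptionalSet (f : (Fin n → ℝ) → ℝ) (Q : HalfOpenCube n) : Set (Fin n → ℝ) :=
  {x ∈ Q.points | ∃ R : HalfOpenCube n, R.side ≤ Q.side ∧ x ∈ R.closedCube ∧
    sharpConst n * meanOsc f Q.triple.closedCube * volume R.closedCube <
      ∫⁻ y in R.closedCube, ‖f y - ⨍ z in Q.triple.closedCube, f z‖ₑ}

theorem HalfOpenCube.subset_triple {Q R : HalfOpenCube n} (hside : R.side ≤ Q.side)
    {x : Fin n → ℝ} (hx : x ∈ Q.points) (hxR : x ∈ R.closedCube) :
    R.closedCube ⊆ Q.triple.closedCube := by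
  refine fun y hy => ⟨fun i => ?_, fun i => ?_⟩
  · have h := mem_points.1 hx i
    have h1 := hxR.2 i
    have h2 := hy.1 i
    simp only [triple]
    linarith
  · have h := mem_points.1 hx i
    have h1 := hxR.1 i
    have h2 := hy.2 i
    simp only [triple]
    linarith

theorem lintegral_triple_eq (f : (Fin n → ℝ) → ℝ) (Q : HalfOpenCube n) :
    ∫⁻ y in Q.triple.closedCube, ‖f y - ⨍ z in Q.triple.closedCube, f z‖ₑ =
      meanOsc f Q.triple.closedCube * volume Q.triple.closedCube := by
  rw [meanOsc, ENNReal.div_mul_cancel Q.triple.volume_closedCube_ne_zero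
    Q.triple.volume_closedCube_ne_top]

theorem meanOsc_triple_ne_top (hf : LocallyIntegrable f volume) (Q : HalfOpenCube n) :
    meanOsc f Q.triple.closedCube ≠ ∞ := by
  have h1 : IntegrableOn f Q.triple.closedCube volume := hf.integrableOn_isCompact isCompact_Icc
  have h2 : IntegrableOn (fun y => f y - ⨍ z in Q.triple.closedCube, f z)
      Q.triple.closedCube volume :=
    h1.sub (integrableOn_const Q.triple.volume_closedCube_ne_top)
  exact ENNReal.div_ne_top h2.2.ne Q.triple.volume_closedCube_ne_zero

/-- The weak-type bound on `3Q` loses `5 ^ n` from Vitali and `3 ^ n` from tripling; the factor `2 ^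
(n + 3)` in `sharpConst` is what remains. -/
theorem volume_exceptionalSet_le (hf : LocallyIntegrable f volume) (Q : HalfOpenCube n) :
    2 ^ (n + 3) * volume (exceptionalSet f Q) ≤ volume Q.points := by
  set a := meanOsc f Q.triple.closedCube with ha
  have hint := lintegral_triple_eq f Q
  rw [← ha] at hint
  have hatop : a ≠ ∞ := meanOsc_triple_ne_top hf Q
  -- The weak-type bound is divided by `a` below; if `a = 0`, no small cube can carry positive
  -- oscillation.
  by_cases ha0 : a = 0
  · have : exceptionalSet f Q = ∅ := by
      refine eq_empty_of_forall_notMem ?_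
      rintro x ⟨hx, R, hR, hxR, hlt⟩
      refine absurd ((lintegral_mono_set (HalfOpenCube.subset_triple hR hx hxR)).trans
        hint.le) (not_le.2 ?_)
      rw [ha0, zero_mul]
      exact pos_of_gt hlt
    simp [this]
  · have h := HalfOpenCube.mul_volume_le_of_forall_exists_average (n := n)
      (fun y => ‖f y - ⨍ z in Q.triple.closedCube, f z‖ₑ) (E := exceptionalSet f Q)
      (K := Q.triple.closedCube) Q.side (sharpConst n * a) (by
        rintro x ⟨hx, R, hR, hxR, hlt⟩
        exact ⟨R, hR, hxR, HalfOpenCube.subset_triple hR hx hxR, hlt.le⟩)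
    have hv : volume Q.triple.closedCube = 3 ^ n * volume Q.points := by
      rw [HalfOpenCube.volume_closedCube, HalfOpenCube.volume_points, ← mul_pow]
      congr 1
      simp only [HalfOpenCube.triple]
      rw [ENNReal.ofReal_mul (by norm_num), ENNReal.ofReal_ofNat]
    rw [hint, hv, sharpConst] at h
    have e15 : (15 : ℝ≥0∞) ^ n = 5 ^ n * 3 ^ n := by
      rw [← mul_pow]
      norm_num
    have h' : (15 ^ n * a) * (2 ^ (n + 3) * volume (exceptionalSet f Q)) ≤
        (15 ^ n * a) * volume Q.points := by
      calc _ = 2 ^ (n + 3) * 15 ^ n * a * volume (exceptionalSet f Q) := by ring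
        _ ≤ _ := h
        _ = _ := by rw [e15]; ring
    exact (ENNReal.mul_le_mul_iff_right (mul_ne_zero (by simp) ha0) (by finiteness)).1 h'

/-- The oscillation is measured on a cube containing all of `Q`, so `z` is independent of `x`. This
freedom keeps the evaluation point fixed during the iteration. -/
theorem hlMaximal_le_of_notMem_exceptionalSet {Q : HalfOpenCube n} {x z : Fin n → ℝ}
    (hx : x ∈ Q.points) (hxE : x ∉ exceptionalSet f Q) (hz : z ∈ Q.points) :
    hlMaximal f x ≤ infMaximal f Q + sharpConst n * sharpMaximal f z := by
  refine iSup₂_le ?_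
  rintro _ ⟨hK, hxK⟩
  obtain ⟨R, rfl⟩ := hK.exists_closedCube
  rcases le_total Q.side R.side with h | h
  · refine (average_le_of_side_le h hx hxK hz).trans ?_
    gcongr
    rw [sharpConst, pow_add, mul_assoc]
    refine le_mul_of_one_le_right (zero_le) ?_
    exact one_le_mul (one_le_pow₀ (by norm_num)) (one_le_pow₀ (by norm_num))
  · have hle : ∫⁻ y in R.closedCube, ‖f y - ⨍ z in Q.triple.closedCube, f z‖ₑ ≤
        sharpConst n * meanOsc f Q.triple.closedCube * volume R.closedCube :=
      not_lt.1 fun hlt => hxE ⟨hx, R, h, hxK, hlt⟩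
    refine (average_le_enorm_add R (⨍ y in Q.triple.closedCube, f y)).trans
      (add_le_add (enorm_setAverage_le_infMaximal Q.points_subset_triple) ?_)
    refine (ENNReal.div_le_of_le_mul hle).trans ?_
    gcongr
    exact meanOsc_le_sharpMaximal _ (Q.points_subset_triple hz)

/-- One step of the sparse decomposition. -/
theorem exists_sparse_children (hf : LocallyIntegrable f volume) (Q : HalfOpenCube n) :
    ∃ S : Set (HalfOpenCube n), S.Countable ∧ S.PairwiseDisjoint HalfOpenCube.points ∧
      (∀ P ∈ S, P.points ⊆ Q.points) ∧
      2 * volume (⋃ P ∈ S, P.points) ≤ volume Q.points ∧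
      (∀ x ∈ Q.points \ ⋃ P ∈ S, P.points,
        hlMaximal f x ≤ infMaximal f Q + sharpConst n * sharpMaximal f x) ∧
      ∀ P ∈ S, ∀ x ∈ P.points,
        infMaximal f P ≤ infMaximal f Q + sharpConst n * sharpMaximal f x := by
  -- The slack between `n + 3` and `n + 2` leaves room for an open superset by outer regularity.
  have hsmall : volume (exceptionalSet f Q) < volume Q.points / 2 ^ (n + 2) := by
    rw [ENNReal.lt_div_iff_mul_lt (Or.inl (by simp)) (Or.inl (by finiteness))]
    have h := volume_exceptionalSet_le hf Q
    by_cases h0 : volume (exceptionalSet f Q) = 0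
    · rw [h0, zero_mul]
      exact pos_iff_ne_zero.2 Q.volume_points_ne_zero
    · refine lt_of_lt_of_le ?_ h
      have hfin : volume (exceptionalSet f Q) ≠ ∞ :=
        ne_top_of_le_ne_top Q.volume_points_ne_top (measure_mono fun _ hx => hx.1)
      rw [mul_comm]
      refine ENNReal.mul_lt_mul_left h0 hfin ?_
      exact_mod_cast (Nat.pow_lt_pow_right (by norm_num) (by omega) : 2 ^ (n + 2) < 2 ^ (n + 3))
  obtain ⟨U, hEU, hU, hUvol⟩ := (exceptionalSet f Q).exists_isOpen_lt_of_lt _ hsmall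
  have hUQ : 2 ^ (n + 2) * volume (U ∩ Q.points) ≤ volume Q.points := by
    rw [mul_comm]
    exact ENNReal.mul_le_of_le_div ((measure_mono inter_subset_left).trans hUvol.le)
  obtain ⟨S, hc, hd, hsub, hcov, hnot, hv⟩ := Q.exists_calderonZygmund hU hUQ
  refine ⟨S, hc, hd, hsub, hv, ?_, ?_⟩
  · rintro x ⟨hx, hxS⟩
    exact hlMaximal_le_of_notMem_exceptionalSet hx (fun h => hxS (hcov ⟨hEU h, hx⟩)) hx
  · intro P hP x hx
    obtain ⟨y, hy, hyU⟩ := not_subset.1 (hnot P hP)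
    exact (iInf₂_le y hy).trans (hlMaximal_le_of_notMem_exceptionalSet (hsub P hP hy)
      (fun h => hyU (hEU h)) (hsub P hP hx))

end LocalOscillation

/-! ### Moments of counting functions under Carleson packing -/

section Moments

variable {α : Type*}

/-- The number of sets among `Ω j, Ω (j + 1), …` containing a point. -/
noncomputable def countFrom (Ω : ℕ → Set α) (j : ℕ) (x : α) : ℝ≥0∞ :=
  ∑' i, (Ω (j + i)).indicator 1 x

theorem countFrom_eq_add (Ω : ℕ → Set α) (j : ℕ) (x : α) :
    countFrom Ω j x = (Ω j).indicator 1 x + countFrom Ω (j + 1) x := by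
  rw [countFrom, tsum_eq_zero_add' ENNReal.summable, countFrom]
  simp only [add_zero, add_assoc, add_comm 1]

theorem countFrom_eq_zero {Ω : ℕ → Set α} (hΩ : Antitone Ω) {j : ℕ} {x : α} (hx : x ∉ Ω j) :
    countFrom Ω j x = 0 :=
  ENNReal.tsum_eq_zero.2 fun i =>
    indicator_of_notMem (fun h => hx (hΩ (Nat.le_add_right j i) h)) _

theorem measurable_countFrom [MeasurableSpace α] {Ω : ℕ → Set α}
    (hm : ∀ i, MeasurableSet (Ω i)) (j : ℕ) : Measurable (countFrom Ω j) :=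
  Measurable.tsum fun i => measurable_one.indicator (hm (j + i))

/-- A discrete derivative bound for `t ^ (k + 1)`, written without subtraction. -/
theorem one_add_pow_succ_le (a : ℝ≥0∞) (k : ℕ) :
    (1 + a) ^ (k + 1) ≤ a ^ (k + 1) + (k + 1) * (1 + a) ^ k := by
  induction k with
  | zero => simp [add_comm]
  | succ k ih =>
    calc (1 + a) ^ (k + 1 + 1) = (1 + a) ^ (k + 1) + a * (1 + a) ^ (k + 1) := by ring
      _ ≤ (1 + a) ^ (k + 1) + a * (a ^ (k + 1) + (k + 1) * (1 + a) ^ k) := by gcongr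
      _ = (1 + a) ^ (k + 1) + (a ^ (k + 1 + 1) + (k + 1) * (a * (1 + a) ^ k)) := by ring
      _ ≤ (1 + a) ^ (k + 1) + (a ^ (k + 1 + 1) + (k + 1) * ((1 + a) * (1 + a) ^ k)) := by
          gcongr
          exact le_add_self
      _ = _ := by
          push_cast
          ring

/-- Telescoping: on `Ω j` the count drops by one from `j` to `j + 1`, so each power difference is at
most `(k + 1)` times the `k`-th power. A point in every `Ω (j + i)` makes the right side infinite.
-/
theorem countFrom_pow_succ_le {Ω : ℕ → Set α} (hΩ : Antitone Ω) (k j : ℕ) (x : α) :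
    countFrom Ω j x ^ (k + 1) ≤
      (k + 1) * ∑' i, (Ω (j + i)).indicator (fun y => countFrom Ω (j + i) y ^ k) x := by
  have step : ∀ j, countFrom Ω j x ^ (k + 1) ≤ countFrom Ω (j + 1) x ^ (k + 1) +
      (k + 1) * (Ω j).indicator (fun y => countFrom Ω j y ^ k) x := by
    intro j
    by_cases hx : x ∈ Ω j
    · rw [indicator_of_mem hx, countFrom_eq_add Ω j, indicator_of_mem hx]
      exact one_add_pow_succ_le _ _
    · rw [countFrom_eq_zero hΩ hx]
      simp
  have iter : ∀ m, countFrom Ω j x ^ (k + 1) ≤ countFrom Ω (j + m) x ^ (k + 1) +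
      (k + 1) * ∑ i ∈ Finset.range m,
        (Ω (j + i)).indicator (fun y => countFrom Ω (j + i) y ^ k) x := by
    intro m
    induction m with
    | zero => simp
    | succ m ih =>
      refine ih.trans ((add_le_add_left (step (j + m)) _).trans ?_)
      rw [Finset.sum_range_succ, mul_add, add_assoc, add_assoc,
        add_comm ((k + 1 : ℝ≥0∞) * Set.indicator _ _ x)]
  by_cases h : ∃ m, x ∉ Ω (j + m)
  · obtain ⟨m, hm⟩ := h
    refine (iter m).trans ?_
    rw [countFrom_eq_zero hΩ hm, zero_pow (Nat.succ_ne_zero k), zero_add]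
    gcongr
    exact ENNReal.sum_le_tsum _
  · push Not at h
    have hone : ∀ i, (1 : ℝ≥0∞) ≤
        (Ω (j + i)).indicator (fun y => countFrom Ω (j + i) y ^ k) x := by
      intro i
      rw [indicator_of_mem (h i)]
      refine one_le_pow₀ ?_
      rw [countFrom_eq_add, indicator_of_mem (h i)]
      exact le_self_add
    have htop : ∑' i, (Ω (j + i)).indicator (fun y => countFrom Ω (j + i) y ^ k) x = ∞ :=
      top_unique ((ENNReal.tsum_const_eq_top_of_ne_zero one_ne_zero).symm.le.trans
        (ENNReal.tsum_le_tsum hone))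
    rw [htop, ENNReal.mul_top (by simp)]
    exact le_top

/-- The moments of the counting function of a nested sequence of sets satisfying a Carleson
packing condition. -/
theorem lintegral_countFrom_pow_le [MeasurableSpace α] {μ : Measure α} {Ω : ℕ → Set α}
    (hm : ∀ i, MeasurableSet (Ω i)) (hΩ : Antitone Ω) {A : ℝ≥0∞}
    (hA : ∀ j, ∑' i, μ (Ω (j + i)) ≤ A * μ (Ω j)) (k j : ℕ) :
    ∫⁻ x in Ω j, countFrom Ω j x ^ k ∂μ ≤ k.factorial * A ^ k * μ (Ω j) := by
  induction k generalizing j with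
  | zero => simp
  | succ k ih =>
    calc ∫⁻ x in Ω j, countFrom Ω j x ^ (k + 1) ∂μ
        ≤ ∫⁻ x, (k + 1) * ∑' i,
            (Ω (j + i)).indicator (fun y => countFrom Ω (j + i) y ^ k) x ∂μ :=
          (setLIntegral_le_lintegral _ _).trans
            (lintegral_mono fun x => countFrom_pow_succ_le hΩ k j x)
      _ = (k + 1) * ∑' i, ∫⁻ x in Ω (j + i), countFrom Ω (j + i) x ^ k ∂μ := by
          have hmeas : ∀ i, Measurable
              ((Ω (j + i)).indicator (fun y => countFrom Ω (j + i) y ^ k)) := fun i =>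
            ((measurable_countFrom hm (j + i)).pow_const k).indicator (hm _)
          rw [lintegral_const_mul _ (Measurable.tsum hmeas),
            lintegral_tsum fun i => (hmeas i).aemeasurable]
          simp_rw [lintegral_indicator (hm _)]
      _ ≤ (k + 1) * ∑' i, k.factorial * A ^ k * μ (Ω (j + i)) := by
          gcongr with i
          exact ih (j + i)
      _ ≤ (k + 1) * (k.factorial * A ^ k * (A * μ (Ω j))) := by
          rw [ENNReal.tsum_mul_left]
          gcongr
          exact hA j
      _ = _ := by
          rw [Nat.factorial_succ]
          push_cast
          ring

end Moments

/-! ### Iterating the sparse selection -/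

section SparseTree

variable {n : ℕ}

/-- A rule selecting in every cube a sparse family of disjoint subcubes. -/
structure IsSparseRule (ch : HalfOpenCube n → Set (HalfOpenCube n)) : Prop where
  countable : ∀ Q, (ch Q).Countable
  disjoint : ∀ Q, (ch Q).PairwiseDisjoint HalfOpenCube.points
  subset : ∀ Q, ∀ P ∈ ch Q, P.points ⊆ Q.points
  volume_le : ∀ Q : HalfOpenCube n, 2 * volume (⋃ P ∈ ch Q, P.points) ≤ volume Q.points

/-- The union of the cubes of generation `k` below `Q`. -/
def sparseLevel (ch : HalfOpenCube n → Set (HalfOpenCube n)) :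
    ℕ → HalfOpenCube n → Set (Fin n → ℝ)
  | 0, Q => Q.points
  | k + 1, Q => ⋃ P ∈ ch Q, sparseLevel ch k P

namespace IsSparseRule

variable {ch : HalfOpenCube n → Set (HalfOpenCube n)} (h : IsSparseRule ch)

include h

theorem level_subset (k : ℕ) (Q : HalfOpenCube n) : sparseLevel ch k Q ⊆ Q.points := by
  induction k generalizing Q with
  | zero => exact subset_rfl
  | succ k ih => exact iUnion₂_subset fun P hP => (ih P).trans (h.subset Q P hP)

theorem measurableSet_level (k : ℕ) (Q : HalfOpenCube n) :
    MeasurableSet (sparseLevel ch k Q) := by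
  induction k generalizing Q with
  | zero => exact Q.measurableSet_points
  | succ k ih => exact MeasurableSet.biUnion (h.countable Q) fun P _ => ih P

theorem level_succ_subset (k : ℕ) (Q : HalfOpenCube n) :
    sparseLevel ch (k + 1) Q ⊆ sparseLevel ch k Q := by
  induction k generalizing Q with
  | zero => exact h.level_subset 1 Q
  | succ k ih => exact iUnion₂_mono fun P _ => ih P

theorem antitone_level (Q : HalfOpenCube n) : Antitone fun k => sparseLevel ch k Q :=
  antitone_nat_of_succ_le fun k => h.level_succ_subset k Q

theorem measure_level_succ (μ : Measure (Fin n → ℝ)) (k : ℕ) (Q : HalfOpenCube n) :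
    μ (sparseLevel ch (k + 1) Q) = ∑' P : ch Q, μ (sparseLevel ch k P) :=
  measure_biUnion (h.countable Q) ((h.disjoint Q).mono fun P => h.level_subset k P)
    fun P _ => h.measurableSet_level k P

theorem volume_le_two_mul_diff (Q : HalfOpenCube n) :
    volume Q.points ≤ 2 * volume (Q.points \ ⋃ P ∈ ch Q, P.points) := by
  have hm : MeasurableSet (⋃ P ∈ ch Q, P.points) := h.measurableSet_level 1 Q
  have hsub : (⋃ P ∈ ch Q, P.points) ⊆ Q.points := h.level_subset 1 Q
  have hadd := measure_sdiff_add_inter (μ := volume) Q.points hm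
  rw [inter_eq_self_of_subset_right hsub] at hadd
  refine (ENNReal.add_le_add_iff_right Q.volume_points_ne_top).1 ?_
  calc volume Q.points + volume Q.points
      = 2 * volume (Q.points \ ⋃ P ∈ ch Q, P.points) +
          2 * volume (⋃ P ∈ ch Q, P.points) := by rw [← mul_add, hadd, two_mul]
    _ ≤ _ := by
        gcongr
        exact h.volume_le Q

/-- The sum of the measures of all generations is controlled by the integral of any function
dominating all the averages of the measure. -/
theorem sum_measure_level_le (μ : Measure (Fin n → ℝ)) (v : (Fin n → ℝ) → ℝ≥0∞) (m : ℕ)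
    (Q : HalfOpenCube n)
    (hv : ∀ P : HalfOpenCube n, P.points ⊆ Q.points → ∀ x ∈ P.points,
      μ P.points / volume P.points ≤ v x) :
    ∑ k ∈ Finset.range m, μ (sparseLevel ch k Q) ≤ 2 * ∫⁻ x in Q.points, v x := by
  induction m generalizing Q with
  | zero => simp
  | succ m ih =>
    have hm : MeasurableSet (⋃ P ∈ ch Q, P.points) := h.measurableSet_level 1 Q
    have hsub : (⋃ P ∈ ch Q, P.points) ⊆ Q.points := h.level_subset 1 Q
    rw [Finset.sum_range_succ']
    simp only [h.measure_level_succ]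
    rw [← Summable.tsum_finsetSum fun _ _ => ENNReal.summable]
    -- Induction pays for later generations with the integral over the children; the root is paid
    -- for by the uncovered part, which is at least half of `Q`.
    have h1 : ∑' P : ch Q, ∑ k ∈ Finset.range m, μ (sparseLevel ch k P) ≤
        2 * ∫⁻ x in ⋃ P ∈ ch Q, P.points, v x := by
      rw [lintegral_biUnion (h.countable Q) (fun P _ => P.measurableSet_points) (h.disjoint Q),
        ← ENNReal.tsum_mul_left]
      refine ENNReal.tsum_le_tsum fun P => ih P fun P' hP' => hv P' ?_
      exact hP'.trans (h.subset Q P P.2)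
    have h2 : μ (sparseLevel ch 0 Q) ≤
        2 * ∫⁻ x in Q.points \ ⋃ P ∈ ch Q, P.points, v x := by
      calc μ Q.points = μ Q.points / volume Q.points * volume Q.points := by
            rw [ENNReal.div_mul_cancel Q.volume_points_ne_zero Q.volume_points_ne_top]
        _ ≤ μ Q.points / volume Q.points *
              (2 * volume (Q.points \ ⋃ P ∈ ch Q, P.points)) := by
            gcongr
            exact h.volume_le_two_mul_diff Q
        _ = 2 * ∫⁻ _ in Q.points \ ⋃ P ∈ ch Q, P.points, μ Q.points / volume Q.points := by
            rw [setLIntegral_const]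
            ring
        _ ≤ _ := by
            gcongr 2 * ?_
            exact setLIntegral_mono' (Q.measurableSet_points.diff hm)
              fun x hx => hv Q subset_rfl x hx.1
    refine (add_le_add h1 h2).trans ?_
    rw [← mul_add, ← lintegral_inter_add_sdiff v Q.points hm, inter_eq_self_of_subset_right hsub]

/-- Packing below every single cube adds up over the disjoint subtrees, giving the condition from
each level onward that the moment bound needs. -/
theorem tsum_measure_level_add_le {μ : Measure (Fin n → ℝ)} {A : ℝ≥0∞}
    (hA : ∀ Q : HalfOpenCube n, ∑' k, μ (sparseLevel ch k Q) ≤ A * μ Q.points) (j : ℕ)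
    (Q : HalfOpenCube n) :
    ∑' i, μ (sparseLevel ch (j + i) Q) ≤ A * μ (sparseLevel ch j Q) := by
  induction j generalizing Q with
  | zero => simpa [sparseLevel] using hA Q
  | succ j ih =>
    simp only [Nat.add_right_comm j 1, h.measure_level_succ]
    rw [ENNReal.tsum_comm, ← ENNReal.tsum_mul_left]
    exact ENNReal.tsum_le_tsum fun P => ih P

/-- Lebesgue measure has averages one, so the level measures are summable; Borel–Cantelli concludes.
-/
theorem ae_exists_notMem_level (Q : HalfOpenCube n) :
    ∀ᵐ x, ∃ k, x ∉ sparseLevel ch k Q := by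
  have hsum : ∑' k, volume (sparseLevel ch k Q) ≤ 2 * volume Q.points := by
    refine ENNReal.tsum_le_of_sum_range_le fun m => ?_
    refine (h.sum_measure_level_le volume (fun _ => 1) m Q fun P _ x _ => ?_).trans ?_
    · exact ENNReal.div_self_le_one
    · simp
  have hfin : ∑' k, volume (sparseLevel ch k Q) ≠ ∞ :=
    ne_top_of_le_ne_top (ENNReal.mul_ne_top (by simp) Q.volume_points_ne_top) hsum
  filter_upwards [ae_eventually_notMem hfin] with x hx
  exact hx.exists

end IsSparseRule

variable {f w : (Fin n → ℝ) → ℝ}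

/-- Each of the `k` descents costs one term, and the good-point bound in the last cube costs one
more. -/
theorem hlMaximal_le_of_mem_level {ch : HalfOpenCube n → Set (HalfOpenCube n)}
    (hgood : ∀ Q : HalfOpenCube n, ∀ x ∈ Q.points \ ⋃ P ∈ ch Q, P.points,
      hlMaximal f x ≤ infMaximal f Q + sharpConst n * sharpMaximal f x)
    (hch : ∀ Q : HalfOpenCube n, ∀ P ∈ ch Q, ∀ x ∈ P.points,
      infMaximal f P ≤ infMaximal f Q + sharpConst n * sharpMaximal f x)
    (h : IsSparseRule ch) (k : ℕ) (Q : HalfOpenCube n) {x : Fin n → ℝ}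
    (hx : x ∈ sparseLevel ch k Q) (hx' : x ∉ sparseLevel ch (k + 1) Q) :
    hlMaximal f x ≤ infMaximal f Q + (k + 1) * (sharpConst n * sharpMaximal f x) := by
  induction k generalizing Q with
  | zero => simpa using hgood Q x ⟨hx, hx'⟩
  | succ k ih =>
    obtain ⟨P, hP, hxP⟩ := mem_iUnion₂.1 hx
    have h1 := ih P hxP fun hxk => hx' (mem_biUnion hP hxk)
    refine (h1.trans (add_le_add_left (hch Q P hP x (h.level_subset k P hxP)) _)).trans ?_
    push_cast
    rw [add_assoc]
    gcongr
    apply le_of_eq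
    ring

/-- Pointwise sparse domination of the oscillation of the maximal function. -/
theorem exists_sparseRule_hlMaximal_le (hf : LocallyIntegrable f volume) :
    ∃ ch : HalfOpenCube n → Set (HalfOpenCube n), IsSparseRule ch ∧
      ∀ Q : HalfOpenCube n, ∀ᵐ x, x ∈ Q.points → hlMaximal f x ≤ infMaximal f Q +
        countFrom (fun k => sparseLevel ch k Q) 0 x * (sharpConst n * sharpMaximal f x) := by
  choose ch hc hd hs hv hgood hch using fun Q => exists_sparse_children (n := n) hf Q
  have h : IsSparseRule ch := ⟨hc, hd, hs, hv⟩
  refine ⟨ch, h, fun Q => ?_⟩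
  filter_upwards [h.ae_exists_notMem_level Q] with x hx hxQ
  classical
  -- Level zero is `Q` itself, so the first level missing `x` is a successor; levels `0, …, k` then
  -- contribute `k + 1` to the count.
  obtain ⟨k, hk⟩ : ∃ k, Nat.find hx = k + 1 :=
    Nat.exists_eq_succ_of_ne_zero fun h0 => Nat.find_spec hx (by rw [h0]; exact hxQ)
  have hnot := Nat.find_spec hx
  rw [hk] at hnot
  have hmem : ∀ i ≤ k, x ∈ sparseLevel ch i Q := fun i hi =>
    not_not.1 (Nat.find_min hx (by omega))
  refine (hlMaximal_le_of_mem_level hgood hch h k Q (hmem k le_rfl) hnot).trans ?_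
  gcongr
  refine le_trans ?_ (ENNReal.sum_le_tsum (Finset.range (k + 1)))
  rw [Finset.sum_congr rfl fun i hi => by
    rw [zero_add, indicator_of_mem (hmem i (Nat.lt_succ_iff.1 (Finset.mem_range.1 hi)))]]
  simp

end SparseTree

/-! ### Weighted estimates for the counting function -/

section Weighted

variable {n : ℕ} {f w : (Fin n → ℝ) → ℝ}

/-- The measure with density `w`. -/
noncomputable def weightMeasure (w : (Fin n → ℝ) → ℝ) : Measure (Fin n → ℝ) :=
  volume.withDensity fun x => ENNReal.ofReal (w x)

theorem weightMeasure_points (w : (Fin n → ℝ) → ℝ) (Q : HalfOpenCube n) :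
    weightMeasure w Q.points = weightMass w Q.closedCube := by
  rw [weightMeasure, withDensity_apply _ Q.measurableSet_points, weightMass,
    setLIntegral_congr Q.points_ae_eq_closedCube]

theorem weightMass_ne_top (hw : IsWeight w) (Q : HalfOpenCube n) :
    weightMass w Q.closedCube ≠ ∞ := by
  have h : IntegrableOn w Q.closedCube volume := hw.1.integrableOn_isCompact isCompact_Icc
  exact ne_top_of_le_ne_top h.2.ne (lintegral_mono fun x => Real.ofReal_le_enorm _)

theorem weightMass_ne_zero (hw : IsWeight w) (Q : HalfOpenCube n) :
    weightMass w Q.closedCube ≠ 0 := by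
  intro h0
  have hmeas : AEMeasurable (fun x => ENNReal.ofReal (w x)) (volume.restrict Q.closedCube) :=
    hw.1.aestronglyMeasurable.aemeasurable.ennreal_ofReal.restrict
  have hz := (lintegral_eq_zero_iff' hmeas).1 h0
  have hfalse : ∀ᵐ x ∂volume.restrict Q.closedCube, False := by
    filter_upwards [hz, ae_restrict_of_ae hw.2] with x hx hpos
    exact absurd hx (by simpa using hpos)
  rw [ae_iff] at hfalse
  simp only [not_false_eq_true, ofPred_true, Measure.restrict_apply_univ] at hfalse
  exact Q.volume_closedCube_ne_zero hfalse

theorem weightMeasure_average_le {P Q : HalfOpenCube n} (hPQ : P.points ⊆ Q.points)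
    {x : Fin n → ℝ} (hx : x ∈ P.points) :
    weightMeasure w P.points / volume P.points ≤ hlMaximal (Q.closedCube.indicator w) x := by
  refine le_trans ?_ (average_le_hlMaximal P (P.points_subset_closedCube hx))
  rw [measure_congr P.points_ae_eq_closedCube]
  gcongr
  rw [weightMeasure, withDensity_apply _ P.measurableSet_points]
  calc ∫⁻ y in P.points, ENNReal.ofReal (w y)
      ≤ ∫⁻ y in P.points, ‖Q.closedCube.indicator w y‖ₑ := by
        refine setLIntegral_mono' P.measurableSet_points fun y hy => ?_
        rw [indicator_of_mem (Q.points_subset_closedCube (hPQ hy))]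
        exact Real.ofReal_le_enorm _
    _ ≤ _ := lintegral_mono_set P.points_subset_closedCube

theorem lintegral_hlMaximal_indicator_le (hw : IsWeight w) (Q : HalfOpenCube n) :
    ∫⁻ x in Q.points, hlMaximal (Q.closedCube.indicator w) x ≤
      fujiiWilson w * weightMeasure w Q.points := by
  rw [weightMeasure_points, setLIntegral_congr Q.points_ae_eq_closedCube]
  rw [← ENNReal.div_le_iff_le_mul (Or.inl (weightMass_ne_zero hw Q))
    (Or.inl (weightMass_ne_top hw Q))]
  exact le_iSup₂_of_le Q.closedCube Q.isCube_closedCube le_rfl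

/-- The Fujii–Wilson condition turns sparseness into a Carleson packing condition for the
weighted measure. -/
theorem tsum_weightMeasure_level_le (hw : IsWeight w)
    {ch : HalfOpenCube n → Set (HalfOpenCube n)} (h : IsSparseRule ch) (Q : HalfOpenCube n) :
    ∑' k, weightMeasure w (sparseLevel ch k Q) ≤
      2 * fujiiWilson w * weightMeasure w Q.points := by
  refine ENNReal.tsum_le_of_sum_range_le fun m => ?_
  refine (h.sum_measure_level_le _ (hlMaximal (Q.closedCube.indicator w)) m Q
    fun P hP x hx => weightMeasure_average_le hP hx).trans ?_
  rw [mul_assoc]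
  gcongr
  exact lintegral_hlMaximal_indicator_le hw Q

theorem weightedLpAvg_mono_ae {Q : HalfOpenCube n} {p : ℝ} (hp : 0 ≤ p)
    {g g' : (Fin n → ℝ) → ℝ≥0∞} (hg : ∀ᵐ x, x ∈ Q.points → g x ≤ g' x) :
    weightedLpAvg w Q.closedCube p g ≤ weightedLpAvg w Q.closedCube p g' := by
  rw [weightedLpAvg, weightedLpAvg, ← setLIntegral_congr Q.points_ae_eq_closedCube,
    ← setLIntegral_congr Q.points_ae_eq_closedCube]
  refine ENNReal.rpow_le_rpow (ENNReal.div_le_div_right ?_ _) (by positivity)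
  refine lintegral_mono_ae ((ae_restrict_iff' Q.measurableSet_points).2 ?_)
  filter_upwards [hg] with x hx hxQ
  gcongr
  exact hx hxQ

theorem weightedLpAvg_const_mul {Q : Set (Fin n → ℝ)} {p : ℝ} (hp : 0 < p)
    {c : ℝ≥0∞} (hc : c ≠ ∞) (g : (Fin n → ℝ) → ℝ≥0∞) :
    weightedLpAvg w Q p (fun x => c * g x) = c * weightedLpAvg w Q p g := by
  have hcp : c ^ p ≠ ∞ := ENNReal.rpow_ne_top_of_nonneg hp.le hc
  simp only [weightedLpAvg, ENNReal.mul_rpow_of_nonneg _ _ hp.le, mul_assoc]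
  rw [lintegral_const_mul' _ _ hcp, mul_div_assoc, ENNReal.mul_rpow_of_nonneg _ _ (by positivity),
    ← ENNReal.rpow_mul, mul_one_div_cancel hp.ne', ENNReal.rpow_one]

/-- The weighted averages are `L^p` norms for a probability measure. -/
theorem weightedLpAvg_eq_eLpNorm' (hw : IsWeight w) (Q : HalfOpenCube n) (p : ℝ)
    {g : (Fin n → ℝ) → ℝ≥0∞} (hg : Measurable g) :
    weightedLpAvg w Q.closedCube p g =
      eLpNorm' g p ((weightMeasure w Q.points)⁻¹ • (weightMeasure w).restrict Q.points) := by
  have hmeas : AEMeasurable (fun x => ENNReal.ofReal (w x)) volume :=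
    hw.1.aestronglyMeasurable.aemeasurable.ennreal_ofReal
  rw [weightedLpAvg, eLpNorm', lintegral_smul_measure, ← weightMeasure_points,
    ← setLIntegral_congr Q.points_ae_eq_closedCube, smul_eq_mul, mul_comm, ← div_eq_mul_inv]
  congr 2
  rw [weightMeasure, restrict_withDensity Q.measurableSet_points,
    lintegral_withDensity_eq_lintegral_mul₀ hmeas.restrict (hg.enorm.pow_const p).aemeasurable]
  simp [mul_comm]

/-- Normalized weighted `L^p` norms increase with `p`, so `p` may be raised to the integer `k = ⌈p⌉₊
≤ 2p`. With packing constant `2[w]` and `k! ≤ k ^ k`, the `k`-th root of the moment is at most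
`2k[w] ≤ 4p[w]`. -/
theorem weightedLpAvg_countFrom_le (hw : IsWeight w)
    {ch : HalfOpenCube n → Set (HalfOpenCube n)} (h : IsSparseRule ch) (Q : HalfOpenCube n)
    {p : ℝ} (hp : 1 ≤ p) :
    weightedLpAvg w Q.closedCube p (countFrom (fun k => sparseLevel ch k Q) 0) ≤
      4 * fujiiWilson w * ENNReal.ofReal p := by
  set N := countFrom (fun k => sparseLevel ch k Q) 0 with hN
  set k := ⌈p⌉₊ with hk
  have hpk : p ≤ k := Nat.le_ceil p
  have hk0 : (0 : ℝ) < k := by linarith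
  have hk2 : (k : ℝ) ≤ 2 * p := by
    have := Nat.ceil_lt_add_one (by linarith : 0 ≤ p)
    linarith
  have hm : Measurable N := measurable_countFrom (fun i => h.measurableSet_level i Q) 0
  have h0 : weightMeasure w Q.points ≠ 0 := by
    rw [weightMeasure_points]
    exact weightMass_ne_zero hw Q
  have htop : weightMeasure w Q.points ≠ ∞ := by
    rw [weightMeasure_points]
    exact weightMass_ne_top hw Q
  have hprob : IsProbabilityMeasure
      ((weightMeasure w Q.points)⁻¹ • (weightMeasure w).restrict Q.points) := ⟨by
    rw [Measure.smul_apply, Measure.restrict_apply_univ, smul_eq_mul,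
      ENNReal.inv_mul_cancel h0 htop]⟩
  rw [weightedLpAvg_eq_eLpNorm' hw Q p hm]
  refine (eLpNorm'_le_eLpNorm'_of_exponent_le (by linarith) hpk _
    hm.aestronglyMeasurable).trans ?_
  have hmom := lintegral_countFrom_pow_le (fun i => h.measurableSet_level i Q)
    (h.antitone_level Q)
    (fun j => h.tsum_measure_level_add_le (tsum_weightMeasure_level_le hw h) j Q) k 0
  rw [← hN] at hmom
  simp only [sparseLevel] at hmom
  have hbound : ∫⁻ x, ‖N x‖ₑ ^ (k : ℝ) ∂((weightMeasure w Q.points)⁻¹ •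
      (weightMeasure w).restrict Q.points) ≤ (k * (2 * fujiiWilson w)) ^ (k : ℝ) := by
    rw [lintegral_smul_measure, smul_eq_mul, mul_comm, ← div_eq_mul_inv]
    refine ENNReal.div_le_of_le_mul ?_
    simp only [enorm_eq_self, ENNReal.rpow_natCast]
    refine hmom.trans ?_
    rw [mul_pow (k : ℝ≥0∞)]
    gcongr
    exact_mod_cast Nat.factorial_le_pow k
  rw [eLpNorm']
  refine (ENNReal.rpow_le_rpow hbound (by positivity)).trans ?_
  rw [← ENNReal.rpow_mul, mul_one_div_cancel hk0.ne', ENNReal.rpow_one]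
  have hkp : (k : ℝ≥0∞) ≤ 2 * ENNReal.ofReal p := by
    rw [← ENNReal.ofReal_natCast, ← ENNReal.ofReal_ofNat 2, ← ENNReal.ofReal_mul (by norm_num)]
    exact ENNReal.ofReal_le_ofReal hk2
  calc (k : ℝ≥0∞) * (2 * fujiiWilson w) ≤ 2 * ENNReal.ofReal p * (2 * fujiiWilson w) := by gcongr
    _ = 4 * fujiiWilson w * ENNReal.ofReal p := by ring

end Weighted

/-! ### The main theorem -/

theorem theorem1 (n : ℕ) :
    ∃ c : ℝ, 0 < c ∧
      ∀ (f : (Fin n → ℝ) → ℝ) (w : (Fin n → ℝ) → ℝ),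
        LocallyIntegrable f volume →
        (¬ ∃ a : ℝ, ∀ᵐ x, f x = a) →
        (∃ x, hlMaximal f x ≠ ∞) →
        MemAInfty w →
        (∀ Q : Set (Fin n → ℝ), IsCube Q → ∀ p : ℝ, 1 ≤ p →
          weightedLpAvg w Q p
              (fun x => (hlMaximal f x - essInfOn (hlMaximal f) Q) / sharpMaximal f x)
            ≤ ENNReal.ofReal c * fujiiWilson w * ENNReal.ofReal p) ∧
        (MemBMO f →
          ∀ Q : Set (Fin n → ℝ), IsCube Q → ∀ p : ℝ, 1 ≤ p →
            weightedLpAvg w Q p (fun x => hlMaximal f x - essInfOn (hlMaximal f) Q)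
              ≤ ENNReal.ofReal c * fujiiWilson w * ENNReal.ofReal p * bmoNorm f) := by
  have hK : sharpConst n ≠ ∞ := by
    unfold sharpConst
    finiteness
  have hK0 : sharpConst n ≠ 0 := by simp [sharpConst]
  -- The `4` comes from the counting estimate, `sharpConst` from the pointwise domination.
  refine ⟨4 * (sharpConst n).toReal, mul_pos four_pos (ENNReal.toReal_pos hK0 hK), ?_⟩
  intro f w hf _ _ hw
  have hc : ENNReal.ofReal (4 * (sharpConst n).toReal) = 4 * sharpConst n := by
    rw [ENNReal.ofReal_mul (by norm_num), ENNReal.ofReal_toReal hK, ENNReal.ofReal_ofNat]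
  obtain ⟨ch, h, hdom⟩ := exists_sparseRule_hlMaximal_le hf
  have hosc : ∀ Q : HalfOpenCube n, ∀ᵐ x, x ∈ Q.points →
      hlMaximal f x - essInfOn (hlMaximal f) Q.closedCube ≤
        sharpConst n * countFrom (fun k => sparseLevel ch k Q) 0 x * sharpMaximal f x := by
    intro Q
    filter_upwards [hdom Q] with x hx hxQ
    refine (tsub_le_tsub_left (infMaximal_le_essInfOn f Q) _).trans
      (tsub_le_iff_left.2 ((hx hxQ).trans ?_))
    exact add_le_add le_rfl (le_of_eq (by ring))
  refine ⟨fun K hKc p hp => ?_, fun hbmo K hKc p hp => ?_⟩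
  · obtain ⟨Q, rfl⟩ := hKc.exists_closedCube
    refine (weightedLpAvg_mono_ae (by linarith)
      (g' := fun x => sharpConst n * countFrom (fun k => sparseLevel ch k Q) 0 x) ?_).trans ?_
    · filter_upwards [hosc Q] with x hx hxQ
      -- This covers the degenerate points too: where `M^♯f = 0` the numerator vanishes and `0 / 0 =
      -- 0`; where `M^♯f = ∞` the quotient is `0`.
      exact ENNReal.div_le_of_le_mul (hx hxQ)
    · rw [weightedLpAvg_const_mul (by linarith) hK, hc]
      refine (mul_le_mul_right (weightedLpAvg_countFrom_le hw.1 h Q hp) _).trans (le_of_eq ?_)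
      ring
  · obtain ⟨Q, rfl⟩ := hKc.exists_closedCube
    refine (weightedLpAvg_mono_ae (by linarith)
      (g' := fun x => sharpConst n * bmoNorm f *
        countFrom (fun k => sparseLevel ch k Q) 0 x) ?_).trans ?_
    · filter_upwards [hosc Q] with x hx hxQ
      refine (hx hxQ).trans ?_
      rw [mul_right_comm]
      gcongr
      exact sharpMaximal_le_bmoNorm x
    · rw [weightedLpAvg_const_mul (by linarith) (ENNReal.mul_ne_top hK hbmo.2.ne), hc]
      refine (mul_le_mul_right (weightedLpAvg_countFrom_le hw.1 h Q hp) _).trans (le_of_eq ?_)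
      ring
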